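/- Let $d\ge 1$ and $N$ be natural numbers, let $p\in(1,\infty)$, and let $\Omega\subset\mathbb{R}^d$ be a non-empty, bounded, open set. Let $\mathbb{R}^N_+=[0,\infty)^N$, ordered component-wise, and let $\Phi\colon\mathbb{R}^N_+\to[0,\infty)$ be lower semicontinuous, coercive (there is $\delta>0$ with $\Phi(v)\ge\delta\sum_{i=1}^N v_i$ for all $v\in\mathbb{R}^N_+$) and increasing ($v_i\le w_i$ for all $i$ implies $\Phi(v)\le\Phi(w)$). Let $W^{1,p}_0(\Omega)=\{u\in W^{1,p}(\mathbb{R}^d): u=0\text{ a.e. on }\mathbb{R}^d\setminus\Omega\}$. A $(p,N)$-function of $\Omega$ is an $N$-tuple $u=(u_1,\dots,u_N)$ with $u_i\in W^{1,p}_0(\Omega)$, $u_i\ge 0$ a.e., $\|u_i\|_{L^p}=1$ for all $i$, and $u_iu_j=0$ a.e. in $\Omega$ for all $i\ne j$. Set $$\Lambda^{\Phi,N}_{1,p}(\Omega)=\inf\Big\{\Phi\big(\|\nabla u_1\|_{L^p}^p,\dots,\|\nabla u_N\|_{L^p}^p\big): u\text{ is a }(p,N)\text{-function of }\Omega\Big\}\in[0,\infty].$$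 Then the infimum $\Lambda^{\Phi,N}_{1,p}(\Omega)$ is attained: there exists a $(p,N)$-function $u$ of $\Omega$ with $\Phi\big(\|\nabla u_1\|_{L^p}^p,\dots,\|\nabla u_N\|_{L^p}^p\big)=\Lambda^{\Phi,N}_{1,p}(\Omega)$, that is, a $(p,\Phi)$-eigen-$N$-function of $\Omega$. -/

import Mathlib

open MeasureTheory
open scoped NNReal ENNReal ContDiff

namespace NCheeger

/-- `g` is a weak (distributional) gradient of `u` on `ℝ^d`: both are locally integrable and
`∫ u ∂_v φ = - ∫ ⟨g, v⟩ φ` for all test functions `φ ∈ C_c^∞(ℝ^d)` and all directions `v`. -/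
def HasWeakGradient {d : ℕ} (u : EuclideanSpace ℝ (Fin d) → ℝ)
    (g : EuclideanSpace ℝ (Fin d) → EuclideanSpace ℝ (Fin d)) : Prop :=
  LocallyIntegrable u volume ∧ LocallyIntegrable g volume ∧
    ∀ φ : EuclideanSpace ℝ (Fin d) → ℝ, ContDiff ℝ ∞ φ → HasCompactSupport φ →
      ∀ v : EuclideanSpace ℝ (Fin d),
        ∫ x, u x * fderiv ℝ φ x v = - ∫ x, inner ℝ (g x) v * φ x

/-- A weak gradient is unique up to null sets. -/
theorem HasWeakGradient.ae_eq {d : ℕ} {u : EuclideanSpace ℝ (Fin d) → ℝ}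
    {g g' : EuclideanSpace ℝ (Fin d) → EuclideanSpace ℝ (Fin d)}
    (h : HasWeakGradient u g) (h' : HasWeakGradient u g') : g =ᵐ[volume] g' := by
  refine ae_eq_of_integral_contDiff_smul_eq h.2.1 h'.2.1 fun φ hφ hc => ?_
  have hi := h.2.1.integrable_smul_left_of_hasCompactSupport hφ.continuous hc
  have hi' := h'.2.1.integrable_smul_left_of_hasCompactSupport hφ.continuous hc
  refine ext_inner_left ℝ fun v => ?_
  rw [← integral_inner hi v, ← integral_inner hi' v]
  have e := neg_injective ((h.2.2 φ hφ hc v).symm.trans (h'.2.2 φ hφ hc v))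
  have k : ∀ (G : EuclideanSpace ℝ (Fin d) → EuclideanSpace ℝ (Fin d))
      (x : EuclideanSpace ℝ (Fin d)), inner ℝ v (φ x • G x) = inner ℝ (G x) v * φ x := by
    intro G x
    rw [inner_smul_right, real_inner_comm, mul_comm]
  simp only [k]
  exact e

open Classical in
/-- The weak gradient `∇u`, determined almost everywhere by `HasWeakGradient.ae_eq`
(and `0` if `u` has no weak gradient). -/
noncomputable def weakGradient {d : ℕ} (u : EuclideanSpace ℝ (Fin d) → ℝ) :
    EuclideanSpace ℝ (Fin d) → EuclideanSpace ℝ (Fin d) :=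
  if h : ∃ g, HasWeakGradient u g then h.choose else 0

/-- `u ∈ W^{1,p}(ℝ^d)`: both `u` and its weak gradient are in `L^p(ℝ^d)`. -/
def MemW1p {d : ℕ} (p : ℝ) (u : EuclideanSpace ℝ (Fin d) → ℝ) : Prop :=
  MemLp u (ENNReal.ofReal p) volume ∧
    ∃ g, HasWeakGradient u g ∧ MemLp g (ENNReal.ofReal p) volume

/-- `u ∈ W^{1,p}_0(F)`: `u ∈ W^{1,p}(ℝ^d)` and `u = 0` a.e. on `ℝ^d \ F`. -/
def MemW1pZero {d : ℕ} (p : ℝ) (F : Set (EuclideanSpace ℝ (Fin d)))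
    (u : EuclideanSpace ℝ (Fin d) → ℝ) : Prop :=
  MemW1p p u ∧ ∀ᵐ x, x ∉ F → u x = 0

/-- `u = (u_1, …, u_N)` is a `(p,N)`-function of `F`. -/
structure IsPNFunction {d N : ℕ} (p : ℝ) (F : Set (EuclideanSpace ℝ (Fin d)))
    (u : Fin N → EuclideanSpace ℝ (Fin d) → ℝ) : Prop where
  mem : ∀ i, MemW1pZero p F (u i)
  nonneg : ∀ i, ∀ᵐ x, 0 ≤ u i x
  norm_eq_one : ∀ i, eLpNorm (u i) (ENNReal.ofReal p) volume = 1
  disjoint : ∀ i j, i ≠ j → ∀ᵐ x, x ∈ F → u i x * u j x = 0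

/-- The vector `(‖∇u_1‖_{L^p}^p, …, ‖∇u_N‖_{L^p}^p)` of `ℝ^N_+ = (Fin N → ℝ≥0)`. -/
noncomputable def gradEnergy {d N : ℕ} (p : ℝ)
    (u : Fin N → EuclideanSpace ℝ (Fin d) → ℝ) : Fin N → ℝ≥0 :=
  fun i => (eLpNorm (weakGradient (u i)) (ENNReal.ofReal p) volume ^ p).toNNReal

/-- The first `p`-functional `(Φ,N)`-eigenvalue of `F`, an element of `[0,∞]`. -/
noncomputable def functionalEigenvalue {d N : ℕ} (p : ℝ) (Φ : (Fin N → ℝ≥0) → ℝ≥0)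
    (F : Set (EuclideanSpace ℝ (Fin d))) : ℝ≥0∞ :=
  ⨅ (u : Fin N → EuclideanSpace ℝ (Fin d) → ℝ) (_ : IsPNFunction p F u),
    (Φ (gradEnergy p u) : ℝ≥0∞)

/-- `u` is a `(p,Φ)`-eigen-`N`-function of `F`: a `(p,N)`-function achieving the infimum. -/
def IsEigenNFunction {d N : ℕ} (p : ℝ) (Φ : (Fin N → ℝ≥0) → ℝ≥0)
    (F : Set (EuclideanSpace ℝ (Fin d)))
    (u : Fin N → EuclideanSpace ℝ (Fin d) → ℝ) : Prop :=
  IsPNFunction p F u ∧ (Φ (gradEnergy p u) : ℝ≥0∞) = functionalEigenvalue p Φ F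

/-- `Φ` is coercive: `Φ(v) ≥ δ ‖v‖_1` on `ℝ^N_+` for some `δ > 0`. -/
def IsCoercive {N : ℕ} (Φ : (Fin N → ℝ≥0) → ℝ≥0) : Prop :=
  ∃ δ : ℝ≥0, 0 < δ ∧ ∀ v : Fin N → ℝ≥0, δ * ∑ i, v i ≤ Φ v

end NCheeger

/-! The proof is the direct method. Bumps around `N` distinct points of `Ω` give a competitor, so
the infimum `L` is finite. Coercivity bounds all gradient energies along a minimizing sequence, and
Rellich–Kondrachov (`sobolevBall_isCompact`) gives a subsequence along which every component
converges strongly in `L^p` and every energy converges. Strong convergence preserves the unit norms,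
and almost everywhere convergence of a further subsequence preserves sign, support and disjointness.

The gradients need not converge. Each limit function still has energy at most the limit of the
energies. Lower semicontinuity of `Φ` at the vector of limit energies bounds its value there by `L`,
and monotonicity passes this bound to the energies of the limit functions.

Two analytic facts carry the argument. Lower semicontinuity of the gradient norm comes from uniform
convexity of `L^p` and closedness and convexity of the graph of the weak gradient
(`exists_mem_of_tendsto_of_norm_le`), so no weak limits of gradients are extracted. Compactness
comes from mollification: a Sobolev function is within `rOut * ‖∇u‖` of its mollification in `L^p`,
and mollification turns weak convergence into strong convergence on bounded sets. -/

namespace NCheeger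

open Filter Topology

/-! ### Uniform convexity of `L^p` -/

/-- Midpoint strict convexity of `‖·‖ ^ p` in a strictly convex space. -/
theorem norm_midpoint_rpow_lt {V : Type*} [NormedAddCommGroup V] [NormedSpace ℝ V]
    [StrictConvexSpace ℝ V] {p : ℝ} (hp : 1 < p) {a b : V} (hab : a ≠ b) :
    ‖(1 / 2 : ℝ) • (a + b)‖ ^ p < (‖a‖ ^ p + ‖b‖ ^ p) / 2 := by
  have hp0 : 0 < p := by linarith
  rcases eq_or_ne ‖a‖ ‖b‖ with h | h
  · have h1 : ‖(1 / 2 : ℝ) • a + (1 / 2 : ℝ) • b‖ < ‖a‖ :=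
      norm_combo_lt_of_ne le_rfl h.ge hab (by norm_num) (by norm_num) (by norm_num)
    rw [← smul_add] at h1
    have := Real.rpow_lt_rpow (norm_nonneg _) h1 hp0
    rw [← h]
    linarith
  · have h1 := (strictConvexOn_rpow hp).2 (Set.mem_Ici.2 (norm_nonneg a))
      (Set.mem_Ici.2 (norm_nonneg b)) h (show (0 : ℝ) < 1 / 2 by norm_num)
      (show (0 : ℝ) < 1 / 2 by norm_num) (by norm_num)
    simp only [smul_eq_mul] at h1
    have h2 : ‖(1 / 2 : ℝ) • (a + b)‖ ≤ 1 / 2 * ‖a‖ + 1 / 2 * ‖b‖ := by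
      rw [norm_smul]
      have := norm_add_le a b
      norm_num
      linarith
    have := Real.rpow_le_rpow (norm_nonneg _) h2 hp0.le
    linarith

theorem norm_midpoint_rpow_le {V : Type*} [NormedAddCommGroup V] [NormedSpace ℝ V]
    [StrictConvexSpace ℝ V] {p : ℝ} (hp : 1 < p) (a b : V) :
    ‖(1 / 2 : ℝ) • (a + b)‖ ^ p ≤ (‖a‖ ^ p + ‖b‖ ^ p) / 2 := by
  rcases eq_or_ne a b with rfl | h
  · rw [← two_smul ℝ a, smul_smul]
    norm_num
  · exact (norm_midpoint_rpow_lt hp h).le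

/-- Quantitative strict convexity of `‖·‖ ^ p` in a finite-dimensional strictly convex space. -/
theorem exists_norm_sub_rpow_le {V : Type*} [NormedAddCommGroup V] [NormedSpace ℝ V]
    [StrictConvexSpace ℝ V] [FiniteDimensional ℝ V] {p : ℝ} (hp : 1 < p) {ε : ℝ} (hε : 0 < ε) :
    ∃ C : ℝ, 0 ≤ C ∧ ∀ a b : V, ‖a - b‖ ^ p ≤ ε * (‖a‖ ^ p + ‖b‖ ^ p) +
      C * ((‖a‖ ^ p + ‖b‖ ^ p) / 2 - ‖(1 / 2 : ℝ) • (a + b)‖ ^ p) := by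
  have hp0 : 0 < p := by linarith
  have : ProperSpace V := FiniteDimensional.proper_real V
  have hc : ∀ f : V × V → V, Continuous f → Continuous fun z => ‖f z‖ ^ p := fun f hf =>
    hf.norm.rpow_const fun _ => Or.inr hp0.le
  -- By homogeneity it suffices to treat pairs with `‖a‖ ^ p + ‖b‖ ^ p = 1`. Those with `‖a - b‖ ^ p
  -- ≥ ε` form a compact set, on which the strictly positive midpoint gap has a positive minimum
  -- `m`.
  let K : Set (V × V) := {z | ‖z.1‖ ^ p + ‖z.2‖ ^ p = 1 ∧ ε ≤ ‖z.1 - z.2‖ ^ p}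
  have hle1 : ∀ z : V × V, ‖z.1‖ ^ p + ‖z.2‖ ^ p = 1 → ‖z.1‖ ≤ 1 ∧ ‖z.2‖ ≤ 1 := by
    intro z hz
    have h1 : 0 ≤ ‖z.1‖ ^ p := by positivity
    have h2 : 0 ≤ ‖z.2‖ ^ p := by positivity
    constructor <;> rw [← Real.rpow_le_rpow_iff (norm_nonneg _) zero_le_one hp0, Real.one_rpow] <;>
      linarith
  have hK : IsCompact K := by
    refine (isCompact_closedBall (0 : V × V) 1).of_isClosed_subset ?_ ?_
    · exact (isClosed_eq ((hc _ continuous_fst).add (hc _ continuous_snd)) continuous_const).inter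
        (isClosed_le continuous_const (hc _ (continuous_fst.sub continuous_snd)))
    · intro z hz
      rw [mem_closedBall_zero_iff, Prod.norm_def]
      exact max_le (hle1 z hz.1).1 (hle1 z hz.1).2
  obtain ⟨m, hm, hmK⟩ : ∃ m : ℝ, 0 < m ∧ ∀ z ∈ K,
      m ≤ (‖z.1‖ ^ p + ‖z.2‖ ^ p) / 2 - ‖(1 / 2 : ℝ) • (z.1 + z.2)‖ ^ p := by
    rcases K.eq_empty_or_nonempty with h | h
    · exact ⟨1, one_pos, by simp [h]⟩
    · obtain ⟨z, hz, hzmin⟩ := hK.exists_isMinOn h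
        (f := fun z => (‖z.1‖ ^ p + ‖z.2‖ ^ p) / 2 - ‖(1 / 2 : ℝ) • (z.1 + z.2)‖ ^ p)
        ((((hc _ continuous_fst).add (hc _ continuous_snd)).div_const 2).sub
          (hc _ ((continuous_fst.add continuous_snd).const_smul _))).continuousOn
      refine ⟨_, sub_pos.2 (norm_midpoint_rpow_lt hp ?_), fun w hw => hzmin hw⟩
      intro h
      have := hz.2
      rw [h, sub_self, norm_zero, Real.zero_rpow hp0.ne'] at this
      linarith
  -- On `K` the gap is at least `m` and `‖a - b‖ ≤ 2`, whence the constant `2 ^ p / m`. Off `K` the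
  -- `ε` term suffices, since the gap is nonnegative.
  have hsphere : ∀ a b : V, ‖a‖ ^ p + ‖b‖ ^ p = 1 → ‖a - b‖ ^ p ≤ ε +
      2 ^ p / m * (1 / 2 - ‖(1 / 2 : ℝ) • (a + b)‖ ^ p) := by
    intro a b hab
    have hmid := norm_midpoint_rpow_le hp a b
    rw [hab] at hmid
    rcases le_total ε (‖a - b‖ ^ p) with h | h
    · have h1 := hmK (a, b) ⟨hab, h⟩
      simp only [hab] at h1
      have h2 : ‖a - b‖ ^ p ≤ 2 ^ p := by
        refine Real.rpow_le_rpow (norm_nonneg _) ?_ hp0.le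
        have := norm_sub_le a b
        have := hle1 (a, b) hab
        simp only at this
        linarith
      have h3 : 2 ^ p ≤ 2 ^ p / m * (1 / 2 - ‖(1 / 2 : ℝ) • (a + b)‖ ^ p) := by
        rw [div_mul_eq_mul_div, le_div_iff₀ hm]
        gcongr
      linarith
    · have : 0 ≤ 2 ^ p / m * (1 / 2 - ‖(1 / 2 : ℝ) • (a + b)‖ ^ p) :=
        mul_nonneg (by positivity) (by linarith)
      linarith
  refine ⟨2 ^ p / m, by positivity, fun a b => ?_⟩
  set t := ‖a‖ ^ p + ‖b‖ ^ p with ht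
  have hta : 0 ≤ ‖a‖ ^ p := by positivity
  have htb : 0 ≤ ‖b‖ ^ p := by positivity
  rcases (add_nonneg hta htb).eq_or_lt with h0 | h0
  · have ha : ‖a‖ ^ p = 0 := by linarith
    have hb : ‖b‖ ^ p = 0 := by linarith
    rw [Real.rpow_eq_zero (norm_nonneg _) hp0.ne', norm_eq_zero] at ha hb
    simp [ht, ha, hb, Real.zero_rpow hp0.ne']
  · rw [← ht] at h0
    have hscale : ∀ x : V, ‖t ^ (-(1 / p)) • x‖ ^ p = t⁻¹ * ‖x‖ ^ p := by
      intro x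
      rw [norm_smul, Real.mul_rpow (norm_nonneg _) (norm_nonneg _), Real.norm_of_nonneg (by positivity),
        ← Real.rpow_mul h0.le]
      congr 1
      rw [← Real.rpow_neg_one]
      congr 1
      field_simp
    have key := hsphere (t ^ (-(1 / p)) • a) (t ^ (-(1 / p)) • b) (by
      rw [hscale, hscale, ← mul_add]
      exact inv_mul_cancel₀ h0.ne')
    rw [← smul_sub, ← smul_add, smul_comm (1 / 2 : ℝ), hscale, hscale] at key
    have := mul_le_mul_of_nonneg_left key h0.le
    rw [mul_inv_cancel_left₀ h0.ne'] at this
    refine this.trans_eq ?_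
    field_simp

theorem Lp_norm_rpow_eq_integral {α V : Type*} [MeasurableSpace α] {μ : Measure α}
    [NormedAddCommGroup V] {p : ℝ} (hp : 1 < p) (f : Lp V (ENNReal.ofReal p) μ) :
    Integrable (fun x => ‖f x‖ ^ p) μ ∧ ‖f‖ ^ p = ∫ x, ‖f x‖ ^ p ∂μ := by
  have hp0 : 0 < p := by linarith
  have hP : ENNReal.ofReal p ≠ 0 := by simpa using hp0
  have ht : (ENNReal.ofReal p).toReal = p := ENNReal.toReal_ofReal hp0.le
  have hi := (Lp.memLp f).integrable_norm_rpow hP ENNReal.ofReal_ne_top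
  rw [ht] at hi
  refine ⟨hi, ?_⟩
  have hn : 0 ≤ ∫ x, ‖f x‖ ^ p ∂μ := integral_nonneg fun x => by positivity
  rw [Lp.norm_def, (Lp.memLp f).eLpNorm_eq_integral_rpow_norm hP ENNReal.ofReal_ne_top, ht,
    ENNReal.toReal_ofReal (by positivity), ← Real.rpow_mul hn, inv_mul_cancel₀ hp0.ne',
    Real.rpow_one]

/-- The uniform convexity of `L^p`, in the form of an inequality between `p`-th powers. -/
theorem exists_Lp_norm_sub_rpow_le {α V : Type*} [MeasurableSpace α] {μ : Measure α}
    [NormedAddCommGroup V] [NormedSpace ℝ V] [StrictConvexSpace ℝ V] [FiniteDimensional ℝ V]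
    {p : ℝ} (hp : 1 < p) [Fact (1 ≤ ENNReal.ofReal p)] {ε : ℝ} (hε : 0 < ε) :
    ∃ C : ℝ, 0 ≤ C ∧ ∀ a b : Lp V (ENNReal.ofReal p) μ,
      ‖a - b‖ ^ p ≤ ε * (‖a‖ ^ p + ‖b‖ ^ p) +
        C * ((‖a‖ ^ p + ‖b‖ ^ p) / 2 - ‖(1 / 2 : ℝ) • (a + b)‖ ^ p) := by
  obtain ⟨C, hC, h⟩ := exists_norm_sub_rpow_le (V := V) hp hε
  refine ⟨C, hC, fun a b => ?_⟩
  obtain ⟨ia, ea⟩ := Lp_norm_rpow_eq_integral hp a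
  obtain ⟨ib, eb⟩ := Lp_norm_rpow_eq_integral hp b
  obtain ⟨is, es⟩ := Lp_norm_rpow_eq_integral hp (a - b)
  obtain ⟨im, em⟩ := Lp_norm_rpow_eq_integral hp ((1 / 2 : ℝ) • (a + b))
  have i1 : Integrable (fun x => ‖a x‖ ^ p + ‖b x‖ ^ p) μ := ia.add ib
  have i2 : Integrable (fun x => (‖a x‖ ^ p + ‖b x‖ ^ p) / 2) μ := i1.div_const 2
  have i3 : Integrable (fun x => C * ((‖a x‖ ^ p + ‖b x‖ ^ p) / 2 -
    ‖((1 / 2 : ℝ) • (a + b) : Lp V (ENNReal.ofReal p) μ) x‖ ^ p)) μ := (i2.sub im).const_mul C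
  rw [ea, eb, es, em, ← integral_add ia ib, ← integral_const_mul, ← integral_div,
    ← integral_sub i2 im, ← integral_const_mul, ← integral_add (i1.const_mul ε) i3]
  refine integral_mono_ae is ((i1.const_mul ε).add i3) ?_
  filter_upwards [Lp.coeFn_sub a b, Lp.coeFn_smul (1 / 2 : ℝ) (a + b), Lp.coeFn_add a b]
    with x h1 h2 h3
  simp only [h1, h2, h3, Pi.sub_apply, Pi.smul_apply, Pi.add_apply]
  exact h (a x) (b x)

/-! ### Bounded fibres of closed convex relations -/

/-- If `Y` is a Banach space with a `p`-uniformly convex norm, then the bounded fibres of a closed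
convex relation `G ⊆ X × Y` are closed. -/
theorem exists_mem_of_tendsto_of_norm_le {X Y : Type*} [NormedAddCommGroup X] [NormedSpace ℝ X]
    [NormedAddCommGroup Y] [NormedSpace ℝ Y] [CompleteSpace Y] {p : ℝ} (hp : 1 < p)
    (hY : ∀ ε : ℝ, 0 < ε → ∃ C : ℝ, 0 ≤ C ∧ ∀ a b : Y,
      ‖a - b‖ ^ p ≤ ε * (‖a‖ ^ p + ‖b‖ ^ p) +
        C * ((‖a‖ ^ p + ‖b‖ ^ p) / 2 - ‖(1 / 2 : ℝ) • (a + b)‖ ^ p))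
    {G : Set (X × Y)} (hG : IsClosed G) (hGc : Convex ℝ G) {R : ℝ} {x : ℕ → X} {x₀ : X}
    (hx : Tendsto x atTop (𝓝 x₀)) (hxG : ∀ n, ∃ y, (x n, y) ∈ G ∧ ‖y‖ ≤ R) :
    ∃ y, (x₀, y) ∈ G ∧ ‖y‖ ≤ R := by
  have hp0 : 0 < p := by linarith
  let S : ℕ → Set (X × Y) := fun n => G ∩ (Metric.closedBall x₀ (1 / ((n : ℝ) + 1)) ×ˢ
    Metric.closedBall (0 : Y) R)
  have hSc : ∀ n, Convex ℝ (S n) := fun n =>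
    hGc.inter ((convex_closedBall _ _).prod (convex_closedBall _ _))
  have hSanti : ∀ m n, m ≤ n → S n ⊆ S m := by
    intro m n hmn
    refine Set.inter_subset_inter_right _ (Set.prod_mono_left (Metric.closedBall_subset_closedBall ?_))
    exact one_div_le_one_div_of_le (by positivity) (by exact_mod_cast Nat.succ_le_succ hmn)
  have hSne : ∀ n, (S n).Nonempty := by
    intro n
    obtain ⟨k, hk⟩ := (hx.eventually (Metric.closedBall_mem_nhds x₀
      (show (0 : ℝ) < 1 / ((n : ℝ) + 1) by positivity))).exists
    obtain ⟨y, hy, hyR⟩ := hxG k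
    exact ⟨(x k, y), hy, hk, by simpa using hyR⟩
  -- Almost minimizers of the norm over the decreasing convex sets `S n` will form a Cauchy
  -- sequence: for `k ≥ n` the midpoint of the `k`-th and the `n`-th lies in `S n`, so its `p`-th
  -- power norm is at least `m n`, which forces a small convexity gap.
  let T : ℕ → Set ℝ := fun n => (fun z : X × Y => ‖z.2‖ ^ p) '' S n
  have hTb : ∀ n, BddBelow (T n) := fun n => ⟨0, by rintro _ ⟨z, -, rfl⟩; positivity⟩
  let m : ℕ → ℝ := fun n => sInf (T n)
  have hmle : ∀ n, ∀ z ∈ S n, m n ≤ ‖z.2‖ ^ p := fun n z hz =>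
    csInf_le (hTb n) (Set.mem_image_of_mem _ hz)
  have hmm : Monotone m := fun i j hij =>
    csInf_le_csInf (hTb i) ((hSne j).image _) (Set.image_mono (hSanti i j hij))
  have hmR : ∀ n, m n ≤ R ^ p := by
    intro n
    obtain ⟨z, hz⟩ := hSne n
    refine (hmle n z hz).trans (Real.rpow_le_rpow (norm_nonneg _) ?_ hp0.le)
    simpa using hz.2.2
  obtain ⟨M, hM⟩ : ∃ M, Tendsto m atTop (𝓝 M) :=
    ⟨_, tendsto_atTop_ciSup hmm ⟨R ^ p, by rintro _ ⟨n, rfl⟩; exact hmR n⟩⟩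
  have hmM : ∀ n, m n ≤ M := hmm.ge_of_tendsto hM
  have hM0 : 0 ≤ M := by
    refine le_trans ?_ (hmM 0)
    exact le_csInf ((hSne 0).image _) (by rintro _ ⟨z, -, rfl⟩; positivity)
  have hz : ∀ n, ∃ z ∈ S n, ‖z.2‖ ^ p < M + 1 / ((n : ℝ) + 1) := by
    intro n
    have : m n < M + 1 / ((n : ℝ) + 1) := (hmM n).trans_lt (lt_add_of_pos_right _ (by positivity))
    obtain ⟨_, ⟨z, hz, rfl⟩, h⟩ := exists_lt_of_csInf_lt ((hSne n).image _) this
    exact ⟨z, hz, h⟩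
  choose z hzS hzM using hz
  have hcauchy : CauchySeq fun n => (z n).2 := by
    rw [Metric.cauchySeq_iff']
    intro η hη
    -- The two `p`-th powers sum to at most `2 * (M + 1)`, so this `ε` makes the first term at most
    -- `η ^ p / 2`. The added `1` keeps the denominator positive when `M = 0`.
    obtain ⟨C, hC, hCY⟩ := hY (η ^ p / (4 * (M + 1))) (by positivity)
    have hlim : Tendsto (fun n : ℕ => C * (M + 1 / ((n : ℝ) + 1) - m n)) atTop (𝓝 0) := by
      have := ((tendsto_one_div_add_atTop_nhds_zero_nat (𝕜 := ℝ)).const_add M).sub hM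
      simpa using this.const_mul C
    obtain ⟨n, hn⟩ := (hlim.eventually (gt_mem_nhds (show 0 < η ^ p / 2 by positivity))).exists
    refine ⟨n, fun k hk => ?_⟩
    rw [dist_eq_norm, ← Real.rpow_lt_rpow_iff (norm_nonneg _) hη.le hp0]
    have hk1 : 1 / ((k : ℝ) + 1) ≤ 1 / ((n : ℝ) + 1) :=
      one_div_le_one_div_of_le (by positivity) (by exact_mod_cast Nat.succ_le_succ hk)
    have hn1 : 1 / ((n : ℝ) + 1) ≤ 1 := by
      rw [div_le_one (by positivity)]
      have : (0 : ℝ) ≤ n := by positivity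
      linarith
    have hmid : m n ≤ ‖(1 / 2 : ℝ) • ((z k).2 + (z n).2)‖ ^ p := by
      have := hSc n (hSanti n k hk (hzS k)) (hzS n) (a := 1 / 2) (b := 1 / 2) (by norm_num)
        (by norm_num) (by norm_num)
      have := hmle n _ this
      simpa [smul_add] using this
    have h1 := hCY (z k).2 (z n).2
    have h2 := hzM k
    have h3 := hzM n
    have h4 : η ^ p / (4 * (M + 1)) * (‖(z k).2‖ ^ p + ‖(z n).2‖ ^ p) ≤ η ^ p / 2 := by
      have : ‖(z k).2‖ ^ p + ‖(z n).2‖ ^ p ≤ 2 * (M + 1) := by linarith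
      refine (mul_le_mul_of_nonneg_left this (by positivity)).trans_eq ?_
      field_simp
      norm_num
    have h5 : C * ((‖(z k).2‖ ^ p + ‖(z n).2‖ ^ p) / 2 - ‖(1 / 2 : ℝ) • ((z k).2 + (z n).2)‖ ^ p)
        ≤ C * (M + 1 / ((n : ℝ) + 1) - m n) :=
      mul_le_mul_of_nonneg_left (by linarith) hC
    linarith
  obtain ⟨y, hy⟩ := cauchySeq_tendsto_of_complete hcauchy
  have hx1 : Tendsto (fun n => (z n).1) atTop (𝓝 x₀) := by
    rw [tendsto_iff_dist_tendsto_zero]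
    exact squeeze_zero (fun _ => dist_nonneg) (fun n => (hzS n).2.1)
      (tendsto_one_div_add_atTop_nhds_zero_nat (𝕜 := ℝ))
  refine ⟨y, hG.mem_of_tendsto (hx1.prodMk_nhds hy) (Eventually.of_forall fun n => (hzS n).1), ?_⟩
  exact le_of_tendsto hy.norm (Eventually.of_forall fun n => by simpa using (hzS n).2.2)

/-! ### The graph of the weak gradient in `L^p × L^p` -/

theorem HasWeakGradient.congr {d : ℕ} {u u' : EuclideanSpace ℝ (Fin d) → ℝ}
    {g g' : EuclideanSpace ℝ (Fin d) → EuclideanSpace ℝ (Fin d)} (h : HasWeakGradient u g)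
    (hu : u =ᵐ[volume] u') (hg : g =ᵐ[volume] g') : HasWeakGradient u' g' := by
  refine ⟨h.1.congr hu, h.2.1.congr hg, fun φ hφ hc v => ?_⟩
  have h1 : ∫ x, u' x * fderiv ℝ φ x v = ∫ x, u x * fderiv ℝ φ x v :=
    integral_congr_ae (hu.mono fun x hx => by simp only [hx])
  have h2 : ∫ x, inner ℝ (g' x) v * φ x = ∫ x, inner ℝ (g x) v * φ x :=
    integral_congr_ae (hg.mono fun x hx => by simp only [hx])
  rw [h1, h2, h.2.2 φ hφ hc v]

section Graph

variable {d : ℕ} {P : ℝ≥0∞}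

theorem hasWeakGradient_Lp_iff [Fact (1 ≤ P)]
    (f : Lp ℝ P (volume : Measure (EuclideanSpace ℝ (Fin d))))
    (g : Lp (EuclideanSpace ℝ (Fin d)) P (volume : Measure (EuclideanSpace ℝ (Fin d)))) :
    HasWeakGradient f g ↔ ∀ φ : EuclideanSpace ℝ (Fin d) → ℝ, ContDiff ℝ ∞ φ →
      HasCompactSupport φ → ∀ v : EuclideanSpace ℝ (Fin d),
        ∫ x, f x * fderiv ℝ φ x v = - ∫ x, inner ℝ (g x) v * φ x := by
  refine ⟨fun h => h.2.2, fun h => ⟨?_, ?_, h⟩⟩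
  · exact (Lp.memLp f).locallyIntegrable Fact.out
  · exact (Lp.memLp g).locallyIntegrable Fact.out

/-- Testing the weak gradient identity against `φ` in the direction `v` is testing that a
continuous linear functional on `L^p × L^p` vanishes. -/
theorem exists_clm_weakGradient_test [Fact (1 ≤ P)] {Q : ℝ≥0∞} [Fact (1 ≤ Q)]
    [P.HolderConjugate Q] {φ : EuclideanSpace ℝ (Fin d) → ℝ} (hφ : ContDiff ℝ ∞ φ)
    (hc : HasCompactSupport φ) (v : EuclideanSpace ℝ (Fin d)) :
    ∃ T : (Lp ℝ P (volume : Measure (EuclideanSpace ℝ (Fin d))) ×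
        Lp (EuclideanSpace ℝ (Fin d)) P (volume : Measure (EuclideanSpace ℝ (Fin d)))) →L[ℝ] ℝ,
      ∀ z, T z = 0 ↔ ∫ x, z.1 x * fderiv ℝ φ x v = - ∫ x, inner ℝ (z.2 x) v * φ x := by
  have h1 : MemLp (fun x => fderiv ℝ φ x v) Q volume :=
    ((hφ.continuous_fderiv (by simp)).clm_apply continuous_const).memLp_of_hasCompactSupport
      (hc.fderiv_apply ℝ v)
  have h2 : MemLp (fun x => φ x • v) Q volume :=
    (hφ.continuous.smul continuous_const).memLp_of_hasCompactSupport hc.smul_right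
  let T1 := ((ContinuousLinearMap.mul ℝ ℝ).lpPairing volume P Q).flip (h1.toLp _)
  let T2 := ((innerSL ℝ (E := EuclideanSpace ℝ (Fin d))).lpPairing volume P Q).flip (h2.toLp _)
  refine ⟨T1.comp (ContinuousLinearMap.fst ℝ _ _) + T2.comp (ContinuousLinearMap.snd ℝ _ _),
    fun z => ?_⟩
  have e1 : T1 z.1 = ∫ x, z.1 x * fderiv ℝ φ x v := by
    simp only [T1, ContinuousLinearMap.flip_apply, ContinuousLinearMap.lpPairing_eq_integral]
    exact integral_congr_ae (h1.coeFn_toLp.mono fun x hx => by simp [hx])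
  have e2 : T2 z.2 = ∫ x, inner ℝ (z.2 x) v * φ x := by
    simp only [T2, ContinuousLinearMap.flip_apply, ContinuousLinearMap.lpPairing_eq_integral]
    exact integral_congr_ae (h2.coeFn_toLp.mono fun x hx => by
      simp only [hx, map_smul, smul_eq_mul, mul_comm (φ x)]
      rfl)
  rw [← e1, ← e2, ← add_eq_zero_iff_eq_neg]
  rfl

/-- The graph of the weak gradient in `L^p × L^p`. -/
def weakGradientGraph (d : ℕ) (P : ℝ≥0∞) :
    Set (Lp ℝ P (volume : Measure (EuclideanSpace ℝ (Fin d))) ×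
      Lp (EuclideanSpace ℝ (Fin d)) P (volume : Measure (EuclideanSpace ℝ (Fin d)))) :=
  {z | HasWeakGradient z.1 z.2}

/-- The graph is an intersection of kernels of continuous linear functionals, one for each test
function and direction. -/
theorem weakGradientGraph_isClosed_convex [Fact (1 ≤ P)] {Q : ℝ≥0∞} [Fact (1 ≤ Q)]
    [P.HolderConjugate Q] :
    IsClosed (weakGradientGraph d P) ∧ Convex ℝ (weakGradientGraph d P) := by
  choose T hT using fun (φ : {φ : EuclideanSpace ℝ (Fin d) → ℝ //
    ContDiff ℝ ∞ φ ∧ HasCompactSupport φ}) (v : EuclideanSpace ℝ (Fin d)) =>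
      exists_clm_weakGradient_test (P := P) (Q := Q) φ.2.1 φ.2.2 v
  have : weakGradientGraph d P = ⋂ φ, ⋂ v, {z | T φ v z = 0} := by
    ext z
    simp only [weakGradientGraph, Set.mem_iInter, Set.mem_ofPred_eq, hT, hasWeakGradient_Lp_iff]
    exact ⟨fun h φ v => h φ.1 φ.2.1 φ.2.2 v, fun h φ h1 h2 v => h ⟨φ, h1, h2⟩ v⟩
  rw [this]
  refine ⟨isClosed_iInter fun φ => isClosed_iInter fun v =>
    isClosed_eq (T φ v).continuous continuous_const, convex_iInter fun φ => convex_iInter fun v => ?_⟩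
  exact (LinearMap.ker (T φ v).toLinearMap).convex

end Graph

/-! ### Mollification and difference quotients -/

theorem eLpNorm_ofReal_rpow {α V : Type*} [MeasurableSpace α] {μ : Measure α}
    [NormedAddCommGroup V] {p : ℝ} (hp : 0 < p) (f : α → V) :
    eLpNorm f (ENNReal.ofReal p) μ ^ p = ∫⁻ x, ‖f x‖ₑ ^ p ∂μ := by
  rw [eLpNorm_eq_lintegral_rpow_enorm_toReal (by simpa using hp) ENNReal.ofReal_ne_top,
    ENNReal.toReal_ofReal hp.le, ← ENNReal.rpow_mul, one_div, inv_mul_cancel₀ hp.ne',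
    ENNReal.rpow_one]

/-- Jensen's inequality for the norm of a Bochner integral. -/
theorem enorm_integral_rpow_le {T V : Type*} [MeasurableSpace T] [NormedAddCommGroup V]
    [NormedSpace ℝ V] {μ : Measure T} [IsProbabilityMeasure μ] {p : ℝ} (hp : 1 ≤ p) {f : T → V}
    (hf : AEStronglyMeasurable f μ) : ‖∫ t, f t ∂μ‖ₑ ^ p ≤ ∫⁻ t, ‖f t‖ₑ ^ p ∂μ := by
  have hp0 : 0 < p := by linarith
  have h := eLpNorm'_le_eLpNorm'_of_exponent_le one_pos hp μ hf
  simp only [eLpNorm', ENNReal.rpow_one, one_div, inv_one] at h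
  calc ‖∫ t, f t ∂μ‖ₑ ^ p ≤ ((∫⁻ t, ‖f t‖ₑ ^ p ∂μ) ^ p⁻¹) ^ p :=
        ENNReal.rpow_le_rpow ((enorm_integral_le_lintegral_enorm f).trans h) hp0.le
    _ = _ := by rw [← ENNReal.rpow_mul, inv_mul_cancel₀ hp0.ne', ENNReal.rpow_one]

/-- The `p`-th power of the `L^p` norm of an average is at most the average of the `p`-th powers
of the `L^p` norms. -/
theorem lintegral_enorm_integral_rpow_le {T X V : Type*} [MeasurableSpace T] [MeasurableSpace X]
    [NormedAddCommGroup V] [NormedSpace ℝ V] {μ : Measure T} [IsProbabilityMeasure μ]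
    {ν : Measure X} [SFinite ν] {p : ℝ} (hp : 1 ≤ p) {F : X → T → V}
    (hF : AEStronglyMeasurable (fun z : X × T => F z.1 z.2) (ν.prod μ)) :
    ∫⁻ x, ‖∫ t, F x t ∂μ‖ₑ ^ p ∂ν ≤ ∫⁻ t, ∫⁻ x, ‖F x t‖ₑ ^ p ∂ν ∂μ := by
  rw [← lintegral_lintegral_swap (f := fun x t => ‖F x t‖ₑ ^ p) (hF.enorm.pow_const p)]
  refine lintegral_mono_ae ?_
  filter_upwards [hF.prodMk_left] with x hx
  exact enorm_integral_rpow_le hp hx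

theorem aestronglyMeasurable_translate {d : ℕ} {V : Type*} [NormedAddCommGroup V]
    {g : EuclideanSpace ℝ (Fin d) → V}
    (hg : AEStronglyMeasurable g volume) (ρ : Measure (EuclideanSpace ℝ (Fin d))) [SFinite ρ] :
    AEStronglyMeasurable (fun z : EuclideanSpace ℝ (Fin d) × EuclideanSpace ℝ (Fin d) =>
      g (z.1 - z.2)) ((volume : Measure (EuclideanSpace ℝ (Fin d))).prod ρ) :=
  hg.comp_quasiMeasurePreserving (quasiMeasurePreserving_sub_of_right_invariant _ _)

section Mollifier

variable {d : ℕ} {V : Type*} [NormedAddCommGroup V] [NormedSpace ℝ V]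

/-- The probability measure with density a normalised bump function. -/
noncomputable def bumpMeasure (φ : ContDiffBump (0 : EuclideanSpace ℝ (Fin d))) :
    Measure (EuclideanSpace ℝ (Fin d)) :=
  volume.withDensity fun t => ENNReal.ofReal (φ.normed volume t)

instance (φ : ContDiffBump (0 : EuclideanSpace ℝ (Fin d))) :
    IsProbabilityMeasure (bumpMeasure φ) := by
  constructor
  rw [bumpMeasure, withDensity_apply _ MeasurableSet.univ, Measure.restrict_univ,
    ← ofReal_integral_eq_lintegral_ofReal φ.integrable_normed
      (Eventually.of_forall φ.nonneg_normed), φ.integral_normed, ENNReal.ofReal_one]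

theorem ae_bumpMeasure_norm_lt (φ : ContDiffBump (0 : EuclideanSpace ℝ (Fin d))) :
    ∀ᵐ t ∂bumpMeasure φ, ‖t‖ < φ.rOut := by
  rw [bumpMeasure, ae_withDensity_iff φ.continuous_normed.measurable.ennreal_ofReal]
  refine Eventually.of_forall fun t ht => ?_
  have : t ∈ Function.support (φ.normed volume) := by
    intro h
    simp [h] at ht
  rw [φ.support_normed_eq] at this
  simpa using this

/-- The mollification of `g` by a normalised bump function. -/
noncomputable def mollify (φ : ContDiffBump (0 : EuclideanSpace ℝ (Fin d)))
    (g : EuclideanSpace ℝ (Fin d) → V) : EuclideanSpace ℝ (Fin d) → V :=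
  convolution (φ.normed volume) g (ContinuousLinearMap.lsmul ℝ ℝ) volume

/-- Seen as an average of translates against a probability measure, the mollification becomes
accessible to Jensen's inequality. -/
theorem mollify_eq_integral_bumpMeasure (φ : ContDiffBump (0 : EuclideanSpace ℝ (Fin d)))
    (g : EuclideanSpace ℝ (Fin d) → V) (x : EuclideanSpace ℝ (Fin d)) :
    mollify φ g x = ∫ t, g (x - t) ∂bumpMeasure φ := by
  rw [bumpMeasure, integral_withDensity_eq_integral_toReal_smul
    φ.continuous_normed.measurable.ennreal_ofReal (Eventually.of_forall fun _ => by simp)]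
  simp only [mollify, convolution_def, ContinuousLinearMap.lsmul_apply]
  simp only [ENNReal.toReal_ofReal (φ.nonneg_normed _)]

/-- Jensen's inequality reduces the claim to translates of `g`, and Lebesgue measure is translation
invariant. -/
theorem lintegral_enorm_mollify_rpow_le (φ : ContDiffBump (0 : EuclideanSpace ℝ (Fin d)))
    {p : ℝ} (hp : 1 ≤ p) {g : EuclideanSpace ℝ (Fin d) → V}
    (hg : AEStronglyMeasurable g volume) :
    ∫⁻ x, ‖mollify φ g x‖ₑ ^ p ≤ ∫⁻ x, ‖g x‖ₑ ^ p := by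
  simp only [mollify_eq_integral_bumpMeasure]
  refine (lintegral_enorm_integral_rpow_le hp
    (F := fun x t => g (x - t)) (aestronglyMeasurable_translate hg _)).trans_eq ?_
  simp only [lintegral_sub_right_eq_self (fun x => ‖g x‖ₑ ^ p)]
  simp

theorem integrable_translate_bumpMeasure (φ : ContDiffBump (0 : EuclideanSpace ℝ (Fin d)))
    {g : EuclideanSpace ℝ (Fin d) → V} (hg : LocallyIntegrable g volume)
    (x : EuclideanSpace ℝ (Fin d)) : Integrable (fun t => g (x - t)) (bumpMeasure φ) := by
  rw [bumpMeasure, integrable_withDensity_iff_integrable_smul'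
    φ.continuous_normed.measurable.ennreal_ofReal (Eventually.of_forall fun _ => by simp)]
  simp only [ENNReal.toReal_ofReal (φ.nonneg_normed _)]
  exact φ.hasCompactSupport_normed.convolutionExists_left
    (ContinuousLinearMap.lsmul ℝ ℝ) φ.continuous_normed hg x

/-- The error is itself an average of the differences `g (x - t) - g x`, and only `t` in the support
of the bump contribute. -/
theorem lintegral_enorm_mollify_sub_rpow_le [CompleteSpace V]
    (φ : ContDiffBump (0 : EuclideanSpace ℝ (Fin d)))
    {p : ℝ} (hp : 1 ≤ p) {g : EuclideanSpace ℝ (Fin d) → V} (hg : LocallyIntegrable g volume)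
    {K : ℝ≥0∞} (hK : ∀ t, ‖t‖ < φ.rOut → ∫⁻ x, ‖g (x - t) - g x‖ₑ ^ p ≤ K) :
    ∫⁻ x, ‖mollify φ g x - g x‖ₑ ^ p ≤ K := by
  have h : ∀ x, mollify φ g x - g x = ∫ t, (g (x - t) - g x) ∂bumpMeasure φ := by
    intro x
    rw [integral_sub (integrable_translate_bumpMeasure φ hg x) (integrable_const _),
      mollify_eq_integral_bumpMeasure]
    simp
  simp only [h]
  refine (lintegral_enorm_integral_rpow_le hp (F := fun x t => g (x - t) - g x)
    ((aestronglyMeasurable_translate hg.aestronglyMeasurable _).sub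
      hg.aestronglyMeasurable.comp_fst)).trans ?_
  refine (lintegral_mono_ae ((ae_bumpMeasure_norm_lt φ).mono hK)).trans_eq ?_
  simp

theorem continuous_mollify (φ : ContDiffBump (0 : EuclideanSpace ℝ (Fin d)))
    {g : EuclideanSpace ℝ (Fin d) → V} (hg : LocallyIntegrable g volume) :
    Continuous (mollify φ g) :=
  φ.hasCompactSupport_normed.continuous_convolution_left _ φ.continuous_normed hg

/-- The derivative falls on the bump, and the weak gradient identity for the test function `s ↦ φ (x
- s)` moves it onto `u`. The sign from the reflection cancels the sign from integration by parts. -/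
theorem HasWeakGradient.hasFDerivAt_mollify (φ : ContDiffBump (0 : EuclideanSpace ℝ (Fin d)))
    {u : EuclideanSpace ℝ (Fin d) → ℝ} {g : EuclideanSpace ℝ (Fin d) → EuclideanSpace ℝ (Fin d)}
    (h : HasWeakGradient u g) (x : EuclideanSpace ℝ (Fin d)) :
    HasFDerivAt (mollify φ u) (innerSL ℝ (mollify φ g x)) x := by
  have hφ : ContDiff ℝ ∞ (φ.normed volume) := φ.contDiff_normed
  have hd := φ.hasCompactSupport_normed.hasFDerivAt_convolution_left
    (ContinuousLinearMap.lsmul ℝ ℝ) (hφ.of_le (by simp)) h.1 x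
  refine hd.congr_fderiv (ContinuousLinearMap.ext fun v => ?_)
  have hψ : ContDiff ℝ ∞ fun s => φ.normed volume (x - s) :=
    hφ.comp (contDiff_const.sub contDiff_id)
  have hψc : HasCompactSupport fun s => φ.normed volume (x - s) :=
    φ.hasCompactSupport_normed.comp_homeomorph (Homeomorph.subLeft x)
  have hfd : ∀ s, fderiv ℝ (fun s => φ.normed volume (x - s)) s v
      = - fderiv ℝ (φ.normed volume) (x - s) v := by
    intro s
    have h1 : HasFDerivAt (φ.normed volume) (fderiv ℝ (φ.normed volume) (x - s)) (x - s) :=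
      (hφ.differentiable (by simp)).differentiableAt.hasFDerivAt
    have h2 : HasFDerivAt (fun s => φ.normed volume (x - s)) _ s :=
      h1.comp s ((hasFDerivAt_id s).const_sub x)
    rw [h2.fderiv]
    simp
  have key := h.2.2 _ hψ hψc v
  simp only [hfd, mul_neg, integral_neg, neg_inj] at key
  have hex : ConvolutionExistsAt (fderiv ℝ (φ.normed volume)) u x
      ((ContinuousLinearMap.lsmul ℝ ℝ).precompL (EuclideanSpace ℝ (Fin d))) volume :=
    (φ.hasCompactSupport_normed.fderiv ℝ).convolutionExists_left _
      (hφ.continuous_fderiv (by simp)) h.1 x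
  have e1 : convolution (fderiv ℝ (φ.normed volume)) u
      ((ContinuousLinearMap.lsmul ℝ ℝ).precompL (EuclideanSpace ℝ (Fin d))) volume x v
      = ∫ s, u s * fderiv ℝ (φ.normed volume) (x - s) v := by
    rw [convolution_def, ContinuousLinearMap.integral_apply hex,
      ← integral_sub_left_eq_self _ volume x]
    simp [mul_comm]
  have e2 : innerSL ℝ (mollify φ g x) v = ∫ s, inner ℝ (g s) v * φ.normed volume (x - s) := by
    have hex2 : Integrable (fun t => φ.normed volume t • g (x - t)) volume :=
      φ.hasCompactSupport_normed.convolutionExists_left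
        (ContinuousLinearMap.lsmul ℝ ℝ) φ.continuous_normed h.2.1 x
    rw [innerSL_apply_apply, real_inner_comm, mollify, convolution_def]
    simp only [ContinuousLinearMap.lsmul_apply]
    rw [← integral_inner hex2, ← integral_sub_left_eq_self _ volume x]
    simp [inner_smul_right, mul_comm, real_inner_comm]
  rw [e1, e2, key]

/-- The difference quotient estimate for continuously differentiable functions. -/
theorem lintegral_enorm_translate_sub_rpow_le_of_hasFDerivAt {p : ℝ} (hp : 1 ≤ p)
    {f : EuclideanSpace ℝ (Fin d) → ℝ} {G : EuclideanSpace ℝ (Fin d) → EuclideanSpace ℝ (Fin d)}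
    (hf : ∀ x, HasFDerivAt f (innerSL ℝ (G x)) x) (hG : Continuous G)
    (h : EuclideanSpace ℝ (Fin d)) :
    ∫⁻ x, ‖f (x + h) - f x‖ₑ ^ p ≤ ‖h‖ₑ ^ p * ∫⁻ x, ‖G x‖ₑ ^ p := by
  let μ : Measure ℝ := volume.restrict (Set.Ioc 0 1)
  have : IsProbabilityMeasure μ := ⟨by simp [μ]⟩
  have hcont : ∀ x, Continuous fun t : ℝ => inner ℝ (G (x + t • h)) h := fun x => by fun_prop
  -- The increment is the average over `(0, 1]` of the derivative along the segment from `x` to `x +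
  -- h`, so Jensen's inequality applies again.
  have e : ∀ x, f (x + h) - f x = ∫ t, inner ℝ (G (x + t • h)) h ∂μ := by
    intro x
    have hd : ∀ t : ℝ, HasDerivAt (fun t : ℝ => f (x + t • h)) (inner ℝ (G (x + t • h)) h) t := by
      intro t
      have h1 : HasDerivAt (fun t : ℝ => x + t • h) h t := by
        simpa using ((hasDerivAt_id t).smul_const h).const_add x
      exact (hf (x + t • h)).comp_hasDerivAt t h1
    have := intervalIntegral.integral_eq_sub_of_hasDerivAt (a := 0) (b := 1)
      (fun t _ => hd t) ((hcont x).intervalIntegrable _ _)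
    rw [intervalIntegral.integral_of_le zero_le_one] at this
    rw [this]
    simp
  simp only [e]
  have hF : Continuous fun z : EuclideanSpace ℝ (Fin d) × ℝ =>
    (inner ℝ (G (z.1 + z.2 • h)) h : ℝ) := by fun_prop
  refine (lintegral_enorm_integral_rpow_le hp (F := fun x t => inner ℝ (G (x + t • h)) h)
    hF.aestronglyMeasurable).trans ?_
  have hb : ∀ t : ℝ, ∫⁻ x, ‖inner ℝ (G (x + t • h)) h‖ₑ ^ p
      ≤ ‖h‖ₑ ^ p * ∫⁻ x, ‖G x‖ₑ ^ p := by
    intro t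
    rw [← lintegral_add_right_eq_self (fun x => ‖G x‖ₑ ^ p) (t • h), ← lintegral_const_mul' _ _
      (ENNReal.rpow_ne_top_of_nonneg (by linarith) enorm_ne_top)]
    refine lintegral_mono fun x => ?_
    rw [← ENNReal.mul_rpow_of_nonneg _ _ (by linarith : 0 ≤ p), mul_comm]
    refine ENNReal.rpow_le_rpow ?_ (by linarith)
    rw [← ofReal_norm, ← ofReal_norm, ← ofReal_norm,
      ← ENNReal.ofReal_mul (norm_nonneg _)]
    exact ENNReal.ofReal_le_ofReal (norm_inner_le_norm _ _)
  refine (lintegral_mono hb).trans_eq ?_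
  simp

/-- The standard mollifier of radius `1 / (n + 1)`. -/
noncomputable def stdBump (d n : ℕ) : ContDiffBump (0 : EuclideanSpace ℝ (Fin d)) where
  rIn := 1 / ((n : ℝ) + 1) / 2
  rOut := 1 / ((n : ℝ) + 1)
  rIn_pos := by positivity
  rIn_lt_rOut := half_lt_self (by positivity)

theorem ae_tendsto_mollify_stdBump [CompleteSpace V] {g : EuclideanSpace ℝ (Fin d) → V}
    (hg : LocallyIntegrable g volume) :
    ∀ᵐ x, Tendsto (fun n => mollify (stdBump d n) g x) atTop (𝓝 (g x)) := by
  -- The convergence theorem needs `rOut ≤ K * rIn` with fixed `K`; the inner radius of `stdBump` is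
  -- half the outer one, hence `K = 2`.
  refine ContDiffBump.ae_convolution_tendsto_right_of_locallyIntegrable (K := 2)
    tendsto_one_div_add_atTop_nhds_zero_nat (Eventually.of_forall fun n => ?_) hg
  simp only [stdBump]
  linarith

/-- The difference quotient estimate for Sobolev functions. -/
theorem HasWeakGradient.lintegral_enorm_translate_sub_rpow_le {p : ℝ} (hp : 1 ≤ p)
    {u : EuclideanSpace ℝ (Fin d) → ℝ} {g : EuclideanSpace ℝ (Fin d) → EuclideanSpace ℝ (Fin d)}
    (h : HasWeakGradient u g) (y : EuclideanSpace ℝ (Fin d)) :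
    ∫⁻ x, ‖u (x + y) - u x‖ₑ ^ p ≤ ‖y‖ₑ ^ p * ∫⁻ x, ‖g x‖ₑ ^ p := by
  have hp0 : 0 < p := by linarith
  have hb : ∀ n, ∫⁻ x, ‖mollify (stdBump d n) u (x + y) - mollify (stdBump d n) u x‖ₑ ^ p
      ≤ ‖y‖ₑ ^ p * ∫⁻ x, ‖g x‖ₑ ^ p := fun n =>
    (lintegral_enorm_translate_sub_rpow_le_of_hasFDerivAt hp
      (h.hasFDerivAt_mollify (stdBump d n)) (continuous_mollify _ h.2.1) y).trans
      (mul_le_mul' le_rfl (lintegral_enorm_mollify_rpow_le _ hp h.2.1.aestronglyMeasurable))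
  have hae := ae_tendsto_mollify_stdBump h.1
  have hae' := (measurePreserving_add_right (volume : Measure (EuclideanSpace ℝ (Fin d)))
    y).quasiMeasurePreserving.ae hae
  -- The smooth estimate is uniform in `n`, so Fatou's lemma passes it to the almost everywhere
  -- limit.
  calc ∫⁻ x, ‖u (x + y) - u x‖ₑ ^ p
      = ∫⁻ x, liminf (fun n =>
          ‖mollify (stdBump d n) u (x + y) - mollify (stdBump d n) u x‖ₑ ^ p) atTop := by
        refine lintegral_congr_ae ?_
        filter_upwards [hae, hae'] with x h1 h2
        exact (((ENNReal.continuous_rpow_const (y := p)).tendsto _).comp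
          (h2.sub h1).enorm).liminf_eq.symm
    _ ≤ liminf (fun n => ∫⁻ x, ‖mollify (stdBump d n) u (x + y)
          - mollify (stdBump d n) u x‖ₑ ^ p) atTop := by
        refine lintegral_liminf_le fun n => ?_
        have := continuous_mollify (stdBump d n) h.1
        exact Measurable.pow_const (Continuous.measurable (by fun_prop)) p
    _ ≤ _ := liminf_le_of_le (by isBoundedDefault) fun b hb' => by
        obtain ⟨n, hn⟩ := hb'.exists
        exact hn.trans (hb n)

theorem HasWeakGradient.lintegral_enorm_mollify_sub_rpow_le {p : ℝ} (hp : 1 ≤ p)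
    {u : EuclideanSpace ℝ (Fin d) → ℝ} {g : EuclideanSpace ℝ (Fin d) → EuclideanSpace ℝ (Fin d)}
    (h : HasWeakGradient u g) (φ : ContDiffBump (0 : EuclideanSpace ℝ (Fin d))) :
    ∫⁻ x, ‖mollify φ u x - u x‖ₑ ^ p ≤ ENNReal.ofReal φ.rOut ^ p * ∫⁻ x, ‖g x‖ₑ ^ p := by
  refine NCheeger.lintegral_enorm_mollify_sub_rpow_le φ hp h.1 fun t ht => ?_
  have h1 := h.lintegral_enorm_translate_sub_rpow_le hp (-t)
  simp only [← sub_eq_add_neg] at h1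
  refine h1.trans ?_
  gcongr
  rw [enorm_neg, ← ofReal_norm]
  exact ENNReal.ofReal_le_ofReal ht.le

end Mollifier

/-! ### Rellich–Kondrachov compactness -/

/-- A bounded sequence in `L^p` has a subsequence along which all pairings with `L^q` converge. -/
theorem exists_subseq_tendsto_lpPairing {α : Type*} [MeasurableSpace α] {μ : Measure α}
    [IsSeparable μ] {P Q : ℝ≥0∞} [Fact (1 ≤ P)] [Fact (1 ≤ Q)] [Fact (Q ≠ ⊤)]
    [P.HolderConjugate Q] {u : ℕ → Lp ℝ P μ} {M : ℝ} (hu : ∀ k, ‖u k‖ ≤ M) :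
    ∃ ψ : ℕ → ℕ, StrictMono ψ ∧ ∀ f : Lp ℝ Q μ, ∃ l : ℝ,
      Tendsto (fun k => (ContinuousLinearMap.mul ℝ ℝ).lpPairing μ P Q (u (ψ k)) f) atTop (𝓝 l) := by
  let B := (ContinuousLinearMap.mul ℝ ℝ).lpPairing μ P Q
  -- Sequential Banach–Alaoglu in the dual of `L^q`, which is separable because `q` is finite.
  obtain ⟨l, -, ψ, hψ, h⟩ := WeakDual.isSeqCompact_closedBall ℝ (Lp ℝ Q μ) 0 (‖B‖ * M)
    (x := fun k => StrongDual.toWeakDual (B (u k))) (fun k => by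
      rw [Set.mem_preimage, mem_closedBall_zero_iff]
      exact (B.le_opNorm _).trans (mul_le_mul_of_nonneg_left (hu k) (norm_nonneg _)))
  exact ⟨ψ, hψ, fun f => ⟨l f, ((WeakDual.eval_continuous f).tendsto l).comp h⟩⟩

theorem exists_subseq_ae_tendsto_of_tendsto_Lp {α V : Type*} [MeasurableSpace α] {μ : Measure α}
    [NormedAddCommGroup V] {P : ℝ≥0∞} [Fact (1 ≤ P)] {u : ℕ → Lp V P μ} {f : Lp V P μ}
    (h : Tendsto u atTop (𝓝 f)) :
    ∃ ψ : ℕ → ℕ, StrictMono ψ ∧ ∀ᵐ x ∂μ, Tendsto (fun k => u (ψ k) x) atTop (𝓝 (f x)) :=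
  (tendstoInMeasure_of_tendsto_Lp h).exists_seq_tendsto_ae

section Rellich

variable {d : ℕ}

/-- The value at `x` is the pairing with the bump reflected and translated to `x`. Its `L^q` norm
does not depend on `x`, which yields the uniform bound needed for dominated convergence. -/
theorem exists_mollify_eq_lpPairing {P Q : ℝ≥0∞} [Fact (1 ≤ P)] [Fact (1 ≤ Q)]
    [P.HolderConjugate Q] (φ : ContDiffBump (0 : EuclideanSpace ℝ (Fin d))) :
    ∃ M : ℝ, ∀ x : EuclideanSpace ℝ (Fin d),
      ∃ f : Lp ℝ Q (volume : Measure (EuclideanSpace ℝ (Fin d))), ‖f‖ ≤ M ∧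
        ∀ u : Lp ℝ P (volume : Measure (EuclideanSpace ℝ (Fin d))), mollify φ u x =
          (ContinuousLinearMap.mul ℝ ℝ).lpPairing volume P Q u f := by
  refine ⟨(eLpNorm (φ.normed volume) Q volume).toReal, fun x => ?_⟩
  have hψ : MemLp (fun s => φ.normed volume (x - s)) Q volume :=
    Continuous.memLp_of_hasCompactSupport
      (φ.continuous_normed.comp (continuous_const.sub continuous_id))
      (φ.hasCompactSupport_normed.comp_homeomorph (Homeomorph.subLeft x))
  refine ⟨hψ.toLp _, ?_, fun u => ?_⟩
  · rw [Lp.norm_toLp]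
    refine le_of_eq (congrArg ENNReal.toReal ?_)
    have := eLpNorm_comp_measurePreserving (p := Q)
      (φ.continuous_normed (μ := volume)).aestronglyMeasurable
      (Measure.measurePreserving_sub_left volume x)
    simpa only [Function.comp_def] using this
  · rw [ContinuousLinearMap.lpPairing_eq_integral, mollify, convolution_def,
      ← integral_sub_left_eq_self _ volume x]
    refine integral_congr_ae (hψ.coeFn_toLp.mono fun s hs => ?_)
    simp [hs, mul_comm]

theorem mollify_eq_zero (φ : ContDiffBump (0 : EuclideanSpace ℝ (Fin d))) {M : ℝ}
    {Ω : Set (EuclideanSpace ℝ (Fin d))} (hΩ : Ω ⊆ Metric.closedBall 0 M)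
    {u : EuclideanSpace ℝ (Fin d) → ℝ} (hu : ∀ᵐ x, x ∉ Ω → u x = 0)
    {x : EuclideanSpace ℝ (Fin d)} (hx : M + φ.rOut < ‖x‖) : mollify φ u x = 0 := by
  rw [mollify, convolution_def, ← integral_sub_left_eq_self _ volume x]
  refine integral_eq_zero_of_ae (hu.mono fun s hs => ?_)
  by_cases hsΩ : s ∈ Ω
  · have h1 : ‖s‖ ≤ M := by simpa using hΩ hsΩ
    have h2 : φ.normed volume (x - s) = 0 := by
      rw [← Function.notMem_support, φ.support_normed_eq, mem_ball_zero_iff, not_lt]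
      have := norm_sub_norm_le x s
      linarith
    simp [h2]
  · simp [hs hsΩ]

/-- Mollification turns convergence of all pairings into convergence in `L^p`. -/
theorem exists_tendsto_mollify {p : ℝ} (hp : 1 < p) {Q : ℝ≥0∞} [Fact (1 ≤ ENNReal.ofReal p)]
    [Fact (1 ≤ Q)] [(ENNReal.ofReal p).HolderConjugate Q]
    {Ω : Set (EuclideanSpace ℝ (Fin d))} (hΩ : Bornology.IsBounded Ω)
    {u : ℕ → Lp ℝ (ENNReal.ofReal p) (volume : Measure (EuclideanSpace ℝ (Fin d)))} {R : ℝ}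
    (hu : ∀ k, ‖u k‖ ≤ R) (huΩ : ∀ k, ∀ᵐ x, x ∉ Ω → u k x = 0)
    (hlim : ∀ f : Lp ℝ Q (volume : Measure (EuclideanSpace ℝ (Fin d))), ∃ l : ℝ,
      Tendsto (fun k => (ContinuousLinearMap.mul ℝ ℝ).lpPairing volume (ENNReal.ofReal p) Q
        (u k) f) atTop (𝓝 l))
    (φ : ContDiffBump (0 : EuclideanSpace ℝ (Fin d))) :
    ∃ w : EuclideanSpace ℝ (Fin d) → ℝ, AEStronglyMeasurable w volume ∧
      Tendsto (fun k => eLpNorm (mollify φ (u k) - w) (ENNReal.ofReal p) volume) atTop (𝓝 0) := by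
  have hp0 : 0 < p := by linarith
  obtain ⟨M, hM⟩ := exists_mollify_eq_lpPairing (P := ENNReal.ofReal p) (Q := Q) φ
  choose f hfM hf using hM
  choose l hl using hlim
  obtain ⟨r, hr⟩ := hΩ.subset_closedBall 0
  let B := (ContinuousLinearMap.mul ℝ ℝ).lpPairing
    (volume : Measure (EuclideanSpace ℝ (Fin d))) (ENNReal.ofReal p) Q
  let w : EuclideanSpace ℝ (Fin d) → ℝ := fun x => l (f x)
  have hw : ∀ x, Tendsto (fun k => mollify φ (u k) x) atTop (𝓝 (w x)) := fun x =>
    (hl (f x)).congr fun k => (hf x (u k)).symm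
  have hcont : ∀ k, Continuous (mollify φ (u k)) := fun k =>
    continuous_mollify φ ((Lp.memLp (u k)).locallyIntegrable Fact.out)
  have hwm : Measurable w := measurable_of_tendsto_metrizable (fun k => (hcont k).measurable)
    (tendsto_pi_nhds.2 hw)
  have hbd : ∀ k x, ‖mollify φ (u k) x‖ ≤ ‖B‖ * R * M := by
    intro k x
    rw [hf]
    refine (B.le_opNorm₂ (u k) (f x)).trans ?_
    have := (norm_nonneg _).trans (hu k)
    gcongr
    · exact hu k
    · exact hfM x
  have hwbd : ∀ x, ‖w x‖ ≤ ‖B‖ * R * M := fun x =>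
    le_of_tendsto (hw x).norm (Eventually.of_forall fun k => hbd k x)
  have hzero : ∀ k x, r + φ.rOut < ‖x‖ → mollify φ (u k) x = 0 := fun k x hx =>
    mollify_eq_zero φ hr (huΩ k) hx
  have hwzero : ∀ x, r + φ.rOut < ‖x‖ → w x = 0 := fun x hx =>
    tendsto_nhds_unique (hw x) (by simp only [hzero _ x hx]; exact tendsto_const_nhds)
  refine ⟨w, hwm.aestronglyMeasurable, ?_⟩
  have hdom : Tendsto (fun k => ∫⁻ x, ‖mollify φ (u k) x - w x‖ₑ ^ p) atTop
      (𝓝 (∫⁻ _ : EuclideanSpace ℝ (Fin d), 0)) := by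
    -- Pairing convergence gives pointwise convergence. The majorant is a constant on a ball
    -- containing the supports of all mollifications, and is integrable because `Ω` is bounded.
    refine tendsto_lintegral_of_dominated_convergence
      ((Metric.closedBall 0 (r + φ.rOut)).indicator fun _ =>
        ENNReal.ofReal (‖B‖ * R * M + ‖B‖ * R * M) ^ p) (fun k => ?_) (fun k => ?_) ?_ ?_
    · exact ((hcont k).measurable.sub hwm).enorm.pow_const p
    · refine Eventually.of_forall fun x => ?_
      by_cases hx : x ∈ Metric.closedBall (0 : EuclideanSpace ℝ (Fin d)) (r + φ.rOut)
      · simp only [Set.indicator_of_mem hx]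
        refine ENNReal.rpow_le_rpow ?_ hp0.le
        rw [← ofReal_norm]
        exact ENNReal.ofReal_le_ofReal
          ((norm_sub_le _ _).trans (add_le_add (hbd k x) (hwbd x)))
      · have hx' : r + φ.rOut < ‖x‖ := by simpa using hx
        simp [hzero k x hx', hwzero x hx', hp0]
    · rw [lintegral_indicator Metric.isClosed_closedBall.measurableSet, lintegral_const,
        Measure.restrict_apply_univ]
      exact ENNReal.mul_ne_top (ENNReal.rpow_ne_top_of_nonneg hp0.le ENNReal.ofReal_ne_top)
        measure_closedBall_lt_top.ne
    · refine Eventually.of_forall fun x => ?_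
      have h1 : Tendsto (fun k => mollify φ (u k) x - w x) atTop (𝓝 0) := by
        simpa using (hw x).sub_const (w x)
      have h2 := ((ENNReal.continuous_rpow_const (y := p)).tendsto _).comp h1.enorm
      simpa [Function.comp_def, hp0] using h2
  rw [lintegral_zero] at hdom
  have h3 := ((ENNReal.continuous_rpow_const (y := 1 / p)).tendsto _).comp hdom
  rw [ENNReal.zero_rpow_of_pos (by positivity)] at h3
  refine h3.congr fun k => ?_
  rw [Function.comp_apply, eLpNorm_eq_lintegral_rpow_enorm_toReal (by simpa using hp0)
    ENNReal.ofReal_ne_top, ENNReal.toReal_ofReal hp0.le]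
  rfl

theorem HasWeakGradient.eLpNorm_mollify_sub_le {p : ℝ} (hp : 1 ≤ p)
    {u : EuclideanSpace ℝ (Fin d) → ℝ} {g : EuclideanSpace ℝ (Fin d) → EuclideanSpace ℝ (Fin d)}
    (h : HasWeakGradient u g) (φ : ContDiffBump (0 : EuclideanSpace ℝ (Fin d))) :
    eLpNorm (mollify φ u - u) (ENNReal.ofReal p) volume ≤
      ENNReal.ofReal φ.rOut * eLpNorm g (ENNReal.ofReal p) volume := by
  have hp0 : 0 < p := by linarith
  rw [← ENNReal.rpow_le_rpow_iff hp0, ENNReal.mul_rpow_of_nonneg _ _ hp0.le,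
    eLpNorm_ofReal_rpow hp0, eLpNorm_ofReal_rpow hp0]
  exact h.lintegral_enorm_mollify_sub_rpow_le hp φ

/-- The functions vanishing outside `Ω`, of `L^p` norm at most `1`, having a weak gradient of
`L^p` norm at most `R`. -/
def sobolevBall (p : ℝ) (Ω : Set (EuclideanSpace ℝ (Fin d))) (R : ℝ) :
    Set (Lp ℝ (ENNReal.ofReal p) (volume : Measure (EuclideanSpace ℝ (Fin d)))) :=
  {f | (∀ᵐ x, x ∉ Ω → f x = 0) ∧ ‖f‖ ≤ 1 ∧
    ∃ g : Lp (EuclideanSpace ℝ (Fin d)) (ENNReal.ofReal p)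
      (volume : Measure (EuclideanSpace ℝ (Fin d))), HasWeakGradient f g ∧ ‖g‖ ≤ R}

theorem exists_holderConjugate {p : ℝ} (hp : 1 < p) : ∃ Q : ℝ≥0∞,
    1 ≤ Q ∧ Q ≠ ⊤ ∧ (ENNReal.ofReal p).HolderConjugate Q := by
  have h := Real.HolderConjugate.conjExponent hp
  exact ⟨ENNReal.ofReal p.conjExponent, by simpa using h.symm.lt.le, ENNReal.ofReal_ne_top,
    h.ennrealOfReal⟩

/-- Only the functions converge; a gradient of the limit, with the same bound, is supplied by
uniform convexity and the closed convex graph. -/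
theorem sobolevBall_mem_of_tendsto {p : ℝ} (hp : 1 < p) [Fact (1 ≤ ENNReal.ofReal p)]
    {Ω : Set (EuclideanSpace ℝ (Fin d))} {R : ℝ}
    {u : ℕ → Lp ℝ (ENNReal.ofReal p) (volume : Measure (EuclideanSpace ℝ (Fin d)))}
    {f : Lp ℝ (ENNReal.ofReal p) (volume : Measure (EuclideanSpace ℝ (Fin d)))}
    (hu : ∀ k, u k ∈ sobolevBall p Ω R) (h : Tendsto u atTop (𝓝 f)) : f ∈ sobolevBall p Ω R := by
  obtain ⟨Q, hQ, -, hPQ⟩ := exists_holderConjugate hp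
  have : Fact (1 ≤ Q) := ⟨hQ⟩
  refine ⟨?_, le_of_tendsto h.norm (Eventually.of_forall fun k => (hu k).2.1), ?_⟩
  · obtain ⟨ψ, -, hψ⟩ := exists_subseq_ae_tendsto_of_tendsto_Lp h
    filter_upwards [hψ, ae_all_iff.2 fun k => (hu (ψ k)).1] with x h1 h2 hx
    exact tendsto_nhds_unique h1 (by simp only [h2 _ hx]; exact tendsto_const_nhds)
  · obtain ⟨hc, hconv⟩ := weakGradientGraph_isClosed_convex (d := d) (P := ENNReal.ofReal p) (Q := Q)
    have hY : ∀ ε : ℝ, 0 < ε → ∃ C : ℝ, 0 ≤ C ∧ ∀ a b : Lp (EuclideanSpace ℝ (Fin d))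
        (ENNReal.ofReal p) (volume : Measure (EuclideanSpace ℝ (Fin d))),
        ‖a - b‖ ^ p ≤ ε * (‖a‖ ^ p + ‖b‖ ^ p) +
          C * ((‖a‖ ^ p + ‖b‖ ^ p) / 2 - ‖(1 / 2 : ℝ) • (a + b)‖ ^ p) :=
      fun ε hε => exists_Lp_norm_sub_rpow_le hp hε
    have hmem : ∀ n, ∃ g, (u n, g) ∈ weakGradientGraph d (ENNReal.ofReal p) ∧ ‖g‖ ≤ R :=
      fun n => (hu n).2.2
    exact exists_mem_of_tendsto_of_norm_le hp hY hc hconv h hmem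

/-- The Rellich–Kondrachov theorem. -/
theorem sobolevBall_isCompact {p : ℝ} (hp : 1 < p) [Fact (1 ≤ ENNReal.ofReal p)]
    {Ω : Set (EuclideanSpace ℝ (Fin d))} (hΩ : Bornology.IsBounded Ω) (R : ℝ) :
    IsCompact (sobolevBall p Ω R) := by
  obtain ⟨Q, hQ, hQt, hPQ⟩ := exists_holderConjugate hp
  have : Fact (1 ≤ Q) := ⟨hQ⟩
  have : Fact (Q ≠ ⊤) := ⟨hQt⟩
  refine IsSeqCompact.isCompact fun u hu => ?_
  obtain ⟨ψ, hψ, hlim⟩ := exists_subseq_tendsto_lpPairing (Q := Q) fun k => (hu k).2.1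
  -- The gradient bound makes the mollification error small uniformly in `k`, at a fixed scale `n`.
  -- The function `w` may vary with `η`: closeness of the tail to some function is enough for the
  -- Cauchy property.
  have happrox : ∀ η : ℝ≥0∞, 0 < η → ∃ w : EuclideanSpace ℝ (Fin d) → ℝ,
      AEStronglyMeasurable w volume ∧
        ∀ᶠ k in atTop, eLpNorm (⇑(u (ψ k)) - w) (ENNReal.ofReal p) volume < η := by
    intro η hη
    have hsmall : Tendsto (fun n : ℕ => ENNReal.ofReal (stdBump d n).rOut * ENNReal.ofReal R)
        atTop (𝓝 0) := by
      have h1 : Tendsto (fun n : ℕ => ENNReal.ofReal (stdBump d n).rOut) atTop (𝓝 0) := by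
        rw [← ENNReal.ofReal_zero]
        exact ENNReal.tendsto_ofReal tendsto_one_div_add_atTop_nhds_zero_nat
      simpa using ENNReal.Tendsto.mul_const h1 (Or.inr ENNReal.ofReal_ne_top)
    obtain ⟨n, hn⟩ := (hsmall.eventually (gt_mem_nhds (ENNReal.half_pos hη.ne'))).exists
    obtain ⟨w, hw, hwlim⟩ := exists_tendsto_mollify hp hΩ (fun k => (hu (ψ k)).2.1)
      (fun k => (hu (ψ k)).1) hlim (stdBump d n)
    refine ⟨w, hw, (hwlim.eventually (gt_mem_nhds (ENNReal.half_pos hη.ne'))).mono fun k hk => ?_⟩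
    obtain ⟨g, hg, hgR⟩ := (hu (ψ k)).2.2
    have hm := (continuous_mollify (stdBump d n) hg.1).aestronglyMeasurable (μ := volume)
    have e : (⇑(u (ψ k)) - w : EuclideanSpace ℝ (Fin d) → ℝ) =
        (⇑(u (ψ k)) - mollify (stdBump d n) (u (ψ k))) + (mollify (stdBump d n) (u (ψ k)) - w) := by
      simp
    rw [e]
    refine (eLpNorm_add_le ((Lp.aestronglyMeasurable _).sub hm) (hm.sub hw) Fact.out).trans_lt ?_
    rw [← ENNReal.add_halves η]
    refine ENNReal.add_lt_add (lt_of_le_of_lt ?_ hn) hk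
    rw [eLpNorm_sub_comm]
    refine (hg.eLpNorm_mollify_sub_le hp.le _).trans (mul_le_mul' le_rfl ?_)
    rw [← Lp.enorm_def, ← ofReal_norm]
    exact ENNReal.ofReal_le_ofReal hgR
  have hcauchy : CauchySeq (u ∘ ψ) := by
    rw [EMetric.cauchySeq_iff]
    intro η hη
    obtain ⟨w, hw, hev⟩ := happrox (η / 2) (ENNReal.half_pos hη.ne')
    obtain ⟨n, hn⟩ := eventually_atTop.1 hev
    refine ⟨n, fun k hk l hl => ?_⟩
    rw [Function.comp_apply, Function.comp_apply, Lp.edist_def]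
    have e : (⇑(u (ψ k)) - ⇑(u (ψ l)) : EuclideanSpace ℝ (Fin d) → ℝ) =
        (⇑(u (ψ k)) - w) + (w - ⇑(u (ψ l))) := by simp
    rw [e]
    refine (eLpNorm_add_le ((Lp.aestronglyMeasurable _).sub hw)
      (hw.sub (Lp.aestronglyMeasurable _)) Fact.out).trans_lt ?_
    rw [← ENNReal.add_halves η, eLpNorm_sub_comm w]
    exact ENNReal.add_lt_add (hn k hk) (hn l hl)
  obtain ⟨f, hf⟩ := cauchySeq_tendsto_of_complete hcauchy
  exact ⟨f, sobolevBall_mem_of_tendsto hp (fun k => hu (ψ k)) hf, ψ, hψ, hf⟩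

end Rellich

/-! ### Existence of competitors -/

theorem hasWeakGradient_gradient {d : ℕ} {f : EuclideanSpace ℝ (Fin d) → ℝ}
    (hf : ContDiff ℝ ∞ f) : HasWeakGradient f (gradient f) := by
  have hg : Continuous (gradient f) :=
    (InnerProductSpace.toDual ℝ (EuclideanSpace ℝ (Fin d))).symm.continuous.comp
      (hf.continuous_fderiv (by simp))
  have hi : ∀ x v, inner ℝ (gradient f x) v = fderiv ℝ f x v := fun x v => by
    rw [gradient, InnerProductSpace.toDual_symm_apply]
  refine ⟨hf.continuous.locallyIntegrable, hg.locallyIntegrable, fun φ hφ hc v => ?_⟩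
  simp only [hi]
  have c1 : Continuous fun x => fderiv ℝ f x v :=
    (hf.continuous_fderiv (by simp)).clm_apply continuous_const
  have c2 : Continuous fun x => fderiv ℝ φ x v :=
    (hφ.continuous_fderiv (by simp)).clm_apply continuous_const
  refine integral_mul_fderiv_eq_neg_fderiv_mul_of_integrable ?_ ?_ ?_
    (fun x _ => (hf.differentiable (by simp)).differentiableAt)
    (fun x _ => (hφ.differentiable (by simp)).differentiableAt)
  · exact (c1.mul hφ.continuous).integrable_of_hasCompactSupport hc.mul_left
  · exact (hf.continuous.mul c2).integrable_of_hasCompactSupport (hc.fderiv_apply ℝ v).mul_left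
  · exact (hf.continuous.mul hφ.continuous).integrable_of_hasCompactSupport hc.mul_left

theorem memW1p_of_contDiff {d : ℕ} (p : ℝ) {f : EuclideanSpace ℝ (Fin d) → ℝ}
    (hf : ContDiff ℝ ∞ f) (hc : HasCompactSupport f) : MemW1p p f := by
  have hg : Continuous (gradient f) :=
    (InnerProductSpace.toDual ℝ (EuclideanSpace ℝ (Fin d))).symm.continuous.comp
      (hf.continuous_fderiv (by simp))
  exact ⟨hf.continuous.memLp_of_hasCompactSupport hc, _, hasWeakGradient_gradient hf,
    hg.memLp_of_hasCompactSupport ((hc.fderiv ℝ).comp_left (map_zero _))⟩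

/-- A non-negative test function of unit `L^p` norm supported in a given neighbourhood. -/
theorem exists_normalized_bump {d : ℕ} {p : ℝ} (hp : 0 < p) {s : Set (EuclideanSpace ℝ (Fin d))}
    {x : EuclideanSpace ℝ (Fin d)} (hs : s ∈ 𝓝 x) :
    ∃ f : EuclideanSpace ℝ (Fin d) → ℝ, ContDiff ℝ ∞ f ∧ HasCompactSupport f ∧ (∀ y, 0 ≤ f y) ∧
      (∀ y, y ∉ s → f y = 0) ∧ eLpNorm f (ENNReal.ofReal p) volume = 1 := by
  obtain ⟨f, hfs, hfc, hf, hfr, hfx⟩ := exists_contDiff_tsupport_subset (n := ⊤) hs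
  have hP : ENNReal.ofReal p ≠ 0 := by simpa using hp
  set c := eLpNorm f (ENNReal.ofReal p) volume with hc
  have hct : c ≠ ⊤ := (hf.continuous.memLp_of_hasCompactSupport hfc).eLpNorm_ne_top
  have hc0 : c ≠ 0 := by
    rw [hc, Ne, eLpNorm_eq_zero_iff hf.continuous.aestronglyMeasurable hP,
      hf.continuous.ae_eq_iff_eq volume continuous_zero]
    intro h
    simp [h] at hfx
  refine ⟨fun y => c.toReal⁻¹ * f y, contDiff_const.mul hf, hfc.mul_left, fun y => ?_,
    fun y hy => ?_, ?_⟩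
  · exact mul_nonneg (by positivity) (hfr (Set.mem_range_self y)).1
  · simp only [image_eq_zero_of_notMem_tsupport fun h => hy (hfs h), mul_zero]
  · have := eLpNorm_const_smul (p := ENNReal.ofReal p) (μ := volume) c.toReal⁻¹ f
    rw [← hc] at this
    refine this.trans ?_
    rw [← ofReal_norm, Real.norm_of_nonneg (by positivity),
      ENNReal.ofReal_inv_of_pos (ENNReal.toReal_pos hc0 hct), ENNReal.ofReal_toReal hct,
      ENNReal.inv_mul_cancel hc0 hct]

/-- For `d ≥ 1` a nonempty open set is infinite, so it contains `N` distinct points; normalized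
bumps in disjoint neighbourhoods of these have disjoint supports. -/
theorem exists_isPNFunction {d : ℕ} (N : ℕ) (hd : 1 ≤ d) {p : ℝ} (hp : 0 < p)
    {Ω : Set (EuclideanSpace ℝ (Fin d))} (hne : Ω.Nonempty) (ho : IsOpen Ω) :
    ∃ u : Fin N → EuclideanSpace ℝ (Fin d) → ℝ, IsPNFunction p Ω u := by
  have : Nonempty (Fin d) := ⟨⟨0, hd⟩⟩
  obtain ⟨x₀, hx₀⟩ := hne
  have hinf : Ω.Infinite := infinite_of_mem_nhds x₀ (ho.mem_nhds hx₀)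
  have : Infinite Ω := hinf.to_subtype
  let x : Fin N ↪ EuclideanSpace ℝ (Fin d) :=
    (Fin.valEmbedding.trans (Infinite.natEmbedding Ω)).trans (Function.Embedding.subtype _)
  have hxΩ : ∀ i, x i ∈ Ω := fun i => Subtype.coe_prop _
  obtain ⟨U, hU, hUd⟩ := (Set.finite_range x).t2_separation
  choose f hf hfc hf0 hfU hfn using fun i => exists_normalized_bump hp
    (((hU (x i)).2.inter ho).mem_nhds ⟨(hU (x i)).1, hxΩ i⟩)
  refine ⟨f, fun i => ⟨memW1p_of_contDiff p (hf i) (hfc i), Eventually.of_forall fun y hy =>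
    hfU i y fun h => hy h.2⟩, fun i => Eventually.of_forall (hf0 i), hfn, fun i j hij => ?_⟩
  refine Eventually.of_forall fun y _ => ?_
  by_cases hi : y ∈ U (x i)
  · have hj : y ∉ U (x j) := Set.disjoint_left.1 (hUd (Set.mem_range_self i)
      (Set.mem_range_self j) (x.injective.ne hij)) hi
    rw [hfU j y fun h => hj h.1, mul_zero]
  · rw [hfU i y fun h => hi h.1, zero_mul]

/-! ### The direct method -/

variable {d N : ℕ}

theorem HasWeakGradient.weakGradient_ae_eq {u : EuclideanSpace ℝ (Fin d) → ℝ}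
    {g : EuclideanSpace ℝ (Fin d) → EuclideanSpace ℝ (Fin d)} (h : HasWeakGradient u g) :
    weakGradient u =ᵐ[volume] g := by
  have hex : ∃ g, HasWeakGradient u g := ⟨g, h⟩
  rw [weakGradient, dif_pos hex]
  exact hex.choose_spec.ae_eq h

/-- Energies are `p`-th powers, hence the radius `e ^ (1 / p)`. The convention of `toNNReal` at
infinity plays no role, as the gradient is in `L^p`. -/
theorem IsPNFunction.toLp_mem_sobolevBall {p : ℝ} (hp : 0 < p)
    {Ω : Set (EuclideanSpace ℝ (Fin d))} {u : Fin N → EuclideanSpace ℝ (Fin d) → ℝ}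
    (hu : IsPNFunction p Ω u) {i : Fin N} {e : ℝ≥0} (he : gradEnergy p u i ≤ e) :
    (hu.mem i).1.1.toLp (u i) ∈ sobolevBall p Ω ((e : ℝ) ^ (1 / p)) := by
  obtain ⟨hm, g, hg, hgm⟩ := (hu.mem i).1
  have hcoe := hm.coeFn_toLp
  refine ⟨?_, ?_, hgm.toLp g, hg.congr hcoe.symm hgm.coeFn_toLp.symm, ?_⟩
  · filter_upwards [hcoe, (hu.mem i).2] with x h1 h2 hx
    rw [h1, h2 hx]
  · rw [Lp.norm_toLp, hu.norm_eq_one i, ENNReal.toReal_one]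
  · have h1 : (eLpNorm g (ENNReal.ofReal p) volume ^ p).toNNReal ≤ e := by
      rw [← eLpNorm_congr_ae hg.weakGradient_ae_eq]
      exact he
    rw [Lp.norm_toLp, one_div, Real.le_rpow_inv_iff_of_pos ENNReal.toReal_nonneg e.coe_nonneg hp,
      ENNReal.toReal_rpow]
    exact_mod_cast h1

theorem memW1pZero_of_mem_sobolevBall {p : ℝ} (hp : 0 < p)
    {Ω : Set (EuclideanSpace ℝ (Fin d))}
    {f : Lp ℝ (ENNReal.ofReal p) (volume : Measure (EuclideanSpace ℝ (Fin d)))} {e : ℝ≥0}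
    (hf : f ∈ sobolevBall p Ω ((e : ℝ) ^ (1 / p))) :
    MemW1pZero p Ω f ∧
      (eLpNorm (weakGradient f) (ENNReal.ofReal p) volume ^ p).toNNReal ≤ e := by
  obtain ⟨h0, -, g, hg, hgR⟩ := hf
  refine ⟨⟨⟨Lp.memLp f, g, hg, Lp.memLp g⟩, h0⟩, ?_⟩
  rw [eLpNorm_congr_ae hg.weakGradient_ae_eq]
  rw [one_div, Lp.norm_def, Real.le_rpow_inv_iff_of_pos ENNReal.toReal_nonneg e.coe_nonneg hp,
    ENNReal.toReal_rpow] at hgR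
  exact_mod_cast hgR

/-- The `L^p` limit of a sequence of `(p,N)`-functions is a `(p,N)`-function as soon as its
components are Sobolev functions. -/
theorem isPNFunction_of_tendsto {p : ℝ} [Fact (1 ≤ ENNReal.ofReal p)]
    {Ω : Set (EuclideanSpace ℝ (Fin d))} {u : ℕ → Fin N → EuclideanSpace ℝ (Fin d) → ℝ}
    (hu : ∀ k, IsPNFunction p Ω (u k))
    {f : Fin N → Lp ℝ (ENNReal.ofReal p) (volume : Measure (EuclideanSpace ℝ (Fin d)))}
    (hf : ∀ i, MemW1pZero p Ω (f i))
    (hlim : ∀ i, Tendsto (fun k => ((hu k).mem i).1.1.toLp (u k i)) atTop (𝓝 (f i))) :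
    IsPNFunction p Ω fun i => f i := by
  have hcoe : ∀ i, ∀ᵐ x, ∀ k, ((hu k).mem i).1.1.toLp (u k i) x = u k i x := fun i =>
    ae_all_iff.2 fun k => ((hu k).mem i).1.1.coeFn_toLp
  refine ⟨hf, fun i => ?_, fun i => ?_, fun i j hij => ?_⟩
  · obtain ⟨ψ, -, hψ⟩ := exists_subseq_ae_tendsto_of_tendsto_Lp (hlim i)
    filter_upwards [hψ, hcoe i, ae_all_iff.2 fun k => (hu k).nonneg i] with x h1 h2 h3
    exact ge_of_tendsto h1 (Eventually.of_forall fun k => by rw [h2]; exact h3 _)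
  · have h1 : ‖f i‖ = 1 := by
      refine tendsto_nhds_unique (hlim i).norm ?_
      simp only [Lp.norm_toLp, (hu _).norm_eq_one i, ENNReal.toReal_one]
      exact tendsto_const_nhds
    rwa [Lp.norm_def, ENNReal.toReal_eq_one_iff] at h1
  · obtain ⟨ψ, hψm, hψ⟩ := exists_subseq_ae_tendsto_of_tendsto_Lp (hlim i)
    -- The second subsequence is taken inside the first, so that both factors converge almost
    -- everywhere along it.
    obtain ⟨χ, hχm, hχ⟩ := exists_subseq_ae_tendsto_of_tendsto_Lp
      ((hlim j).comp hψm.tendsto_atTop)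
    filter_upwards [hψ, hχ, hcoe i, hcoe j, ae_all_iff.2 fun k => (hu k).disjoint i j hij]
      with x h1 h2 h3 h4 h5 hx
    refine tendsto_nhds_unique ((h1.comp hχm.tendsto_atTop).mul h2) ?_
    simp only [Function.comp_apply, h3, h4, h5 _ hx]
    exact tendsto_const_nhds

/-- The infimum of the functional eigenvalue is attained. -/
theorem exists_isEigenNFunction (hd : 1 ≤ d) (p : ℝ) (hp : 1 < p)
    (Ω : Set (EuclideanSpace ℝ (Fin d))) (hΩne : Ω.Nonempty) (hΩo : IsOpen Ω)
    (hΩb : Bornology.IsBounded Ω)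
    (Φ : (Fin N → ℝ≥0) → ℝ≥0) (hΦlsc : LowerSemicontinuous Φ)
    (hΦc : IsCoercive Φ) (hΦm : Monotone Φ) :
    ∃ u : Fin N → EuclideanSpace ℝ (Fin d) → ℝ, IsEigenNFunction p Φ Ω u := by
  have hp0 : 0 < p := by linarith
  have : Fact (1 ≤ ENNReal.ofReal p) := ⟨by simpa using hp.le⟩
  obtain ⟨δ, hδ, hΦδ⟩ := hΦc
  obtain ⟨v, hv⟩ := exists_isPNFunction N hd hp0 hΩne hΩo
  have hle : ∀ u, IsPNFunction p Ω u →
      functionalEigenvalue p Φ Ω ≤ (Φ (gradEnergy p u) : ℝ≥0∞) := fun u hu => iInf₂_le u hu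
  obtain ⟨L, hL⟩ : ∃ L : ℝ≥0, (L : ℝ≥0∞) = functionalEigenvalue p Φ Ω :=
    ⟨_, ENNReal.coe_toNNReal (ne_top_of_le_ne_top ENNReal.coe_ne_top (hle v hv))⟩
  have hmin : ∀ k : ℕ, ∃ u : Fin N → EuclideanSpace ℝ (Fin d) → ℝ, IsPNFunction p Ω u ∧
      Φ (gradEnergy p u) < L + 1 / ((k : ℝ≥0) + 1) := by
    intro k
    have h1 : functionalEigenvalue p Φ Ω < ((L + 1 / ((k : ℝ≥0) + 1) : ℝ≥0) : ℝ≥0∞) := by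
      rw [← hL, ENNReal.coe_lt_coe]
      exact lt_add_of_pos_right _ (by positivity)
    simp only [functionalEigenvalue, iInf_lt_iff] at h1
    obtain ⟨u, hu, h2⟩ := h1
    exact ⟨u, hu, ENNReal.coe_lt_coe.1 h2⟩
  choose u hu huΦ using hmin
  -- Coercivity bounds each energy by `Φ / δ`, and `Φ ≤ L + 1` along the whole minimizing sequence.
  have hbound : ∀ k i, gradEnergy p (u k) i ≤ (L + 1) / δ := by
    intro k i
    rw [le_div_iff₀ hδ, mul_comm]
    have h1 : gradEnergy p (u k) i ≤ ∑ j, gradEnergy p (u k) j :=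
      Finset.single_le_sum (fun j _ => zero_le) (Finset.mem_univ i)
    have h2 : 1 / ((k : ℝ≥0) + 1) ≤ 1 := by
      rw [div_le_one (by positivity)]
      exact le_add_of_nonneg_left zero_le
    calc δ * gradEnergy p (u k) i ≤ δ * ∑ j, gradEnergy p (u k) j := mul_le_mul_right h1 δ
      _ ≤ Φ (gradEnergy p (u k)) := hΦδ _
      _ ≤ L + 1 / ((k : ℝ≥0) + 1) := (huΦ k).le
      _ ≤ L + 1 := by gcongr
  -- Functions and energies are compactified together, so a single subsequence serves all
  -- components.
  have hcompact : IsCompact (Set.pi Set.univ fun _ : Fin N =>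
      sobolevBall p Ω ((((L + 1) / δ : ℝ≥0) : ℝ) ^ (1 / p)) ×ˢ Set.Icc 0 ((L + 1) / δ)) :=
    isCompact_univ_pi fun _ => (sobolevBall_isCompact hp hΩb _).prod isCompact_Icc
  obtain ⟨z, -, ψ, hψ, hz⟩ := hcompact.tendsto_subseq
    (x := fun k i => (((hu k).mem i).1.1.toLp (u k i), gradEnergy p (u k) i))
    fun k i _ => ⟨(hu k).toLp_mem_sobolevBall hp0 (hbound k i), zero_le, hbound k i⟩
  rw [tendsto_pi_nhds] at hz
  have hz1 : ∀ i, Tendsto (fun k => ((hu (ψ k)).mem i).1.1.toLp (u (ψ k) i)) atTop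
      (𝓝 (z i).1) := fun i => (continuous_fst.tendsto _).comp (hz i)
  have hz2 : ∀ i, Tendsto (fun k => gradEnergy p (u (ψ k)) i) atTop (𝓝 (z i).2) :=
    fun i => (continuous_snd.tendsto _).comp (hz i)
  -- Eventually the energies lie below their limit plus `η`, so the limit function stays in the
  -- corresponding closed Sobolev ball. Letting `η` tend to `0` afterwards gives lower
  -- semicontinuity of the energy.
  have hmem : ∀ i (η : ℝ≥0), 0 < η →
      (z i).1 ∈ sobolevBall p Ω ((((z i).2 + η : ℝ≥0) : ℝ) ^ (1 / p)) := by
    intro i η hη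
    refine (sobolevBall_isCompact hp hΩb _).isClosed.mem_of_tendsto (hz1 i) ?_
    filter_upwards [(hz2 i).eventually (gt_mem_nhds (lt_add_of_pos_right _ hη))] with k hk
    exact (hu (ψ k)).toLp_mem_sobolevBall hp0 hk.le
  have hPN : IsPNFunction p Ω fun i => (z i).1 :=
    isPNFunction_of_tendsto (fun k => hu (ψ k))
      (fun i => (memW1pZero_of_mem_sobolevBall hp0 (hmem i 1 one_pos)).1) hz1
  have henergy : gradEnergy p (fun i => ⇑(z i).1) ≤ fun i => (z i).2 := fun i =>
    le_of_forall_pos_le_add fun η hη => (memW1pZero_of_mem_sobolevBall hp0 (hmem i η hη)).2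
  -- If `Φ` exceeded `L` at the limit energies, lower semicontinuity would keep it above some `y >
  -- L` along the tail, against the minimizing property.
  have hΦL : Φ (fun i => (z i).2) ≤ L := by
    by_contra! h
    obtain ⟨y, hy1, hy2⟩ := exists_between h
    have hev := (tendsto_pi_nhds.2 hz2).eventually (hΦlsc _ y hy2)
    have hlim : Tendsto (fun k => L + 1 / ((ψ k : ℝ≥0) + 1)) atTop (𝓝 (L + 0)) :=
      (tendsto_one_div_add_atTop_nhds_zero_nat.comp hψ.tendsto_atTop).const_add L
    rw [add_zero] at hlim
    refine hy1.not_ge (ge_of_tendsto hlim (hev.mono fun k hk => ?_))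
    exact (hk.trans (huΦ (ψ k))).le
  refine ⟨_, hPN, le_antisymm ?_ (hle _ hPN)⟩
  rw [← hL, ENNReal.coe_le_coe]
  exact (hΦm henergy).trans hΦL

end NCheeger

theorem mainTheorem12 {d N : ℕ} (hd : 1 ≤ d) (p : ℝ) (hp : 1 < p)
    (Ω : Set (EuclideanSpace ℝ (Fin d))) (hΩne : Ω.Nonempty) (hΩo : IsOpen Ω)
    (hΩb : Bornology.IsBounded Ω)
    (Φ : (Fin N → ℝ≥0) → ℝ≥0) (hΦlsc : LowerSemicontinuous Φ)
    (hΦc : NCheeger.IsCoercive Φ) (hΦm : Monotone Φ) :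
    ∃ u : Fin N → EuclideanSpace ℝ (Fin d) → ℝ, NCheeger.IsEigenNFunction p Φ Ω u := by
  exact NCheeger.exists_isEigenNFunction hd p hp Ω hΩne hΩo hΩb Φ hΦlsc hΦc hΦm
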